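/- Let $R$ be a (Noetherian) Cohen-Macaulay ring, i.e. $\operatorname{depth} R_{\mathfrak m}=\dim R_{\mathfrak m}$ for every maximal ideal $\mathfrak m$, let $I\subset R$ be an ideal of finite height $g$, and let $J=\mathfrak a:_R I$ be an (algebraic) $s$-residual intersection of $I$: that is, $\operatorname{grade}(I)\le s$, $\mathfrak a\subseteq I$ is an ideal generated by $s$ elements, and $\operatorname{ht}(J)\ge s$ (where $\operatorname{ht}(R)=\infty$). Suppose $s\le g+1$. Then $\operatorname{Kitt}(\mathfrak a,I)=J$. Here $\operatorname{Kitt}(\mathfrak a,I)$ is defined as follows. Choose generators $I=(f_1,\dots,f_r)$, generators $\mathfrak a=(a_1,\dots,a_t)$ and an $r\times t$ matrix $\Phi=(c_{ij})$ over $R$ with $(a_1,\dots,a_t)=(f_1,\dots,f_r)\cdot\Phi$. Let $K_\bullet=R\langle e_1,\dots,e_r;\ \partial(e_i)=f_i\rangle$ be the Koszul differential graded algebra, let $\Gamma_\bullet$ be the subalgebra generated by $\zeta_j=\sum_{i=1}^r c_{ij}e_i$ $(1\le j\le t)$, and let $Z_\bullet$ be the algebra of Koszul cycles. Then $\operatorname{Kitt}(\mathfrak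 a,I)=\langle\Gamma_\bullet\cdot Z_\bullet\rangle_r\subseteq K_r=R$ is the degree $r$ part of the subalgebra of $K_\bullet$ generated by $\Gamma_\bullet$ and $Z_\bullet$, where $K_r$ is identified with $R$ through its basis element $e_1\wedge\dots\wedge e_r$. The equality $\operatorname{Kitt}(\mathfrak a,I)=J$ holds for every choice of the $f_i$, the $a_j$ and $\Phi$. (No sliding depth condition is assumed on $I$.) In particular, if $s=1$ and the generators $f_1,\dots,f_r$ of $I$ $(r\ge 1)$ are such that $\mathfrak a=(f_1)$, then $$J=\Bigl\{\alpha_1\in R \;:\; \text{there are } \alpha_2,\dots,\alpha_r\in R \text{ such that all } 2\times 2 \text{ minors of } \begin{pmatrix}\alpha_1&\alpha_2&\cdots&\alpha_r\\ f_1&f_2&\cdots&f_r\end{pmatrix} \text{ vanish}\Bigr\}.$$ -/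

import Mathlib

/-- The grade of an ideal `I` of a (Noetherian) ring: the supremum of the lengths of the `R`-regular
sequences of elements of `I`. For proper `I` a weakly regular sequence in `I` is regular; for
`I = R` the supremum is `∞`, which is the usual convention. -/
noncomputable def idealGrade {R : Type*} [CommRing R] (I : Ideal R) : ℕ∞ :=
  ⨆ (rs : List R) (_ : (∀ x ∈ rs, x ∈ I) ∧ RingTheory.Sequence.IsWeaklyRegular R rs),
    (rs.length : ℕ∞)

/-- A Noetherian ring is Cohen-Macaulay if all its localizations at maximal ideals are
Cohen-Macaulay local rings, that is, satisfy `depth = dim`. -/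
def IsCohenMacaulayRing (R : Type*) [CommRing R] : Prop :=
  IsNoetherianRing R ∧ ∀ (m : Ideal R) [m.IsMaximal],
    (idealGrade (IsLocalRing.maximalIdeal (Localization.AtPrime m)) : WithBot ℕ∞) =
      ringKrullDim (Localization.AtPrime m)

/-- `J = (𝔞 : I)` is an (algebraic) `s`-residual intersection of `I` with respect to `𝔞`. -/
structure IsResidualIntersection {R : Type*} [CommRing R] (𝔞 I J : Ideal R) (s : ℕ) : Prop where
  grade_le : idealGrade I ≤ s
  le : 𝔞 ≤ I
  generators : ∃ a : Fin s → R, Ideal.span (Set.range a) = 𝔞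
  eq_colon : J = Submodule.colon 𝔞 (I : Set R)
  le_height : (s : ℕ∞) ≤ J.height

/-- The differential of the Koszul complex `K(f; R)`, whose underlying algebra is the exterior
algebra of `R ^ r`: the antiderivation with `e i ↦ f i`. -/
noncomputable def koszulDifferential {R : Type*} [CommRing R] {r : ℕ} (f : Fin r → R) :
    ExteriorAlgebra R (Fin r → R) →ₗ[R] ExteriorAlgebra R (Fin r → R) :=
  CliffordAlgebra.contractLeft (Q := (0 : QuadraticForm R (Fin r → R)))
    (Fintype.linearCombination R f)

/-- The Koszul cycles (in all degrees). -/
noncomputable def koszulCycles {R : Type*} [CommRing R] {r : ℕ} (f : Fin r → R) :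
    Submodule R (ExteriorAlgebra R (Fin r → R)) :=
  LinearMap.ker (koszulDifferential f)

/-- The algebra `Γ` generated by the elements `ζ j = ∑ i, c i j • e i` of the Koszul complex, where
`Φ = (c i j)`. -/
noncomputable def koszulGamma {R : Type*} [CommRing R] {r t : ℕ} (Φ : Matrix (Fin r) (Fin t) R) :
    Subalgebra R (ExteriorAlgebra R (Fin r → R)) :=
  Algebra.adjoin R
    (Set.range fun j : Fin t => ∑ i : Fin r, Φ i j • ExteriorAlgebra.ι R (Pi.single i (1 : R)))

/-- The generator `e 1 ∧ ⋯ ∧ e r` of the top degree `K_r ≅ R` of the Koszul complex. -/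
noncomputable def koszulTop (R : Type*) [CommRing R] (r : ℕ) : ExteriorAlgebra R (Fin r → R) :=
  ExteriorAlgebra.ιMulti R r (fun i : Fin r => (Pi.single i 1 : Fin r → R))

/-- The Koszul-Fitting ideal `Kitt(𝔞, I)`, computed from generators `f` of `I` and a matrix `Φ` such
that the entries of `f Φ` generate `𝔞`: the degree `r` part of the subalgebra of the Koszul complex
generated by `Γ` and the Koszul cycles, identified with an ideal through
`R ≅ K_r, x ↦ x • (e 1 ∧ ⋯ ∧ e r)`. -/
noncomputable def kitt {R : Type*} [CommRing R] {r t : ℕ} (f : Fin r → R)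
    (Φ : Matrix (Fin r) (Fin t) R) : Ideal R :=
  Submodule.comap (LinearMap.toSpanSingleton R (ExteriorAlgebra R (Fin r → R)) (koszulTop R r))
    (Subalgebra.toSubmodule
      (Algebra.adjoin R
        ((koszulGamma Φ : Set (ExteriorAlgebra R (Fin r → R))) ∪
          (koszulCycles f : Set (ExteriorAlgebra R (Fin r → R))))))

/-! Write ∂ for the Koszul differential and e for the top basis element. The inclusion Kitt ⊆ J is
formal: by the Leibniz rule, ∂ maps the algebra generated by Γ and the cycles into 𝔞K, and e_i ∧
∂(xe) = x f_i e (`kitt_le_colon`).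

For J ⊆ Kitt, the key point is that if B is generated by a regular sequence inside 𝔞, then every
cycle modulo B already lies in that algebra (`RegChain.mem_gammaCycles`). Since I·J ⊆ 𝔞, the height
of 𝔞 is at least min(g, s), and unmixedness turns min(g, s) of its s generators into a regular
sequence. If s ≤ g, then B = 𝔞, and xe is a cycle modulo B for every x ∈ J.

If s = g + 1, then 𝔞 = B + (α), and x f ≡ α v modulo B for some vector v. With ∂_v the contraction
by v and ∂ζ = α, the element xe − ζ ∂_v e is a cycle modulo B as soon as ∂_v e is one. The latter
follows from an element y ∈ J regular modulo B, which exists because J has height at least g + 1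
(`RegChain.mem_kitt_of_sup_span`). -/

/-! ### Weakly regular sequences and associated primes. -/

section RegularModulo

variable {R : Type*} [CommRing R]

/-- `x` is a nonzerodivisor on `R ⧸ B`. -/
def RegMod (B : Ideal R) (x : R) : Prop := ∀ u, x * u ∈ B → u ∈ B

/-- `B` is generated by a weakly regular sequence of length `k` of elements of `𝔞`. -/
inductive RegChain (𝔞 : Ideal R) : ℕ → Ideal R → Prop
  | bot : RegChain 𝔞 0 ⊥
  | step {k : ℕ} {B : Ideal R} {x : R} (h : RegChain 𝔞 k B) (hx : x ∈ 𝔞) (hreg : RegMod B x) :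
      RegChain 𝔞 (k + 1) (B ⊔ Ideal.span {x})

lemma Ideal.mem_sup_span_singleton' {B : Ideal R} {x u : R} :
    u ∈ B ⊔ Ideal.span {x} ↔ ∃ v, u - x * v ∈ B := by
  constructor
  · intro h
    obtain ⟨b, hb, c, hc, rfl⟩ := Submodule.mem_sup.1 h
    obtain ⟨v, rfl⟩ := Ideal.mem_span_singleton'.1 hc
    exact ⟨v, by simpa [mul_comm] using hb⟩
  · rintro ⟨v, hv⟩
    have := Ideal.add_mem _ (Ideal.mem_sup_left (T := Ideal.span {x}) hv)
      (Ideal.mem_sup_right (S := B) (Ideal.mul_mem_right v _ (Ideal.mem_span_singleton_self x)))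
    simpa using this

lemma RegChain.le {𝔞 B : Ideal R} {k : ℕ} (h : RegChain 𝔞 k B) : B ≤ 𝔞 := by
  induction h with
  | bot => exact bot_le
  | step _ hx _ ih => exact sup_le ih ((Ideal.span_singleton_le_iff_mem _).2 hx)

/-- The elements of the sequence lie in B itself, so the ambient ideal is immaterial. -/
lemma RegChain.mono {𝔞 𝔟 B : Ideal R} {k : ℕ} (h : RegChain 𝔞 k B) (hB : B ≤ 𝔟) :
    RegChain 𝔟 k B := by
  induction h with
  | bot => exact .bot
  | step _ _ hreg ih =>
    exact .step (ih (le_sup_left.trans hB))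
      (hB (Ideal.mem_sup_right (Ideal.mem_span_singleton_self _))) hreg

lemma RegMod.map {B : Ideal R} {x : R} (h : RegMod B x) (M : Submonoid R) (S : Type*) [CommRing S]
    [Algebra R S] [IsLocalization M S] :
    RegMod (B.map (algebraMap R S)) (algebraMap R S x) := by
  intro u hu
  obtain ⟨⟨a, s⟩, hs⟩ := IsLocalization.surj M u
  have key : algebraMap R S (x * a) ∈ B.map (algebraMap R S) := by
    rw [map_mul, ← hs, ← mul_assoc]
    exact Ideal.mul_mem_right _ _ hu
  obtain ⟨t, ht, hta⟩ := (IsLocalization.algebraMap_mem_map_algebraMap_iff M S _ _).1 key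
  have h2 : algebraMap R S a ∈ B.map (algebraMap R S) :=
    (IsLocalization.algebraMap_mem_map_algebraMap_iff M S _ _).2
      ⟨t, ht, h _ (by simpa [mul_left_comm] using hta)⟩
  rw [← hs] at h2
  exact (Ideal.mul_unit_mem_iff_mem _ (IsLocalization.map_units S s)).1 h2

lemma RegChain.map {𝔞 B : Ideal R} {k : ℕ} (h : RegChain 𝔞 k B) (M : Submonoid R) (S : Type*)
    [CommRing S] [Algebra R S] [IsLocalization M S] :
    RegChain (𝔞.map (algebraMap R S)) k (B.map (algebraMap R S)) := by
  induction h with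
  | bot => simpa using RegChain.bot
  | step _ hx hreg ih =>
    rw [Ideal.map_sup, Ideal.map_span, Set.image_singleton]
    exact .step ih (Ideal.mem_map_of_mem _ hx) (hreg.map M S)

lemma isSMulRegular_quotient_iff_regMod (B : Ideal R) (x : R) :
    IsSMulRegular (R ⧸ (B • ⊤ : Submodule R R)) x ↔ RegMod B x := by
  rw [isSMulRegular_iff_right_eq_zero_of_smul]
  constructor
  · intro h u hu
    have := h (Submodule.Quotient.mk u) (by
      rw [← Submodule.Quotient.mk_smul, Submodule.Quotient.mk_eq_zero]
      simpa using hu)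
    rw [Submodule.Quotient.mk_eq_zero] at this
    simpa using this
  · intro h u hu
    induction u using Submodule.Quotient.induction_on with
    | _ u =>
      rw [← Submodule.Quotient.mk_smul, Submodule.Quotient.mk_eq_zero] at hu
      rw [Submodule.Quotient.mk_eq_zero]
      simpa using h u (by simpa using hu)

/-- Associated primes of `R ⧸ B` are of the form `B : u`. -/
lemma exists_colon_of_mem_associatedPrimes [IsNoetherianRing R] {B p : Ideal R}
    (hp : p ∈ associatedPrimes R (R ⧸ B)) : ∃ u, ∀ c, c ∈ p ↔ c * u ∈ B := by
  obtain ⟨-, u, rfl⟩ := isAssociatedPrime_iff.1 hp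
  obtain ⟨u, rfl⟩ := Ideal.Quotient.mk_surjective u
  refine ⟨u, fun c => ?_⟩
  rw [Submodule.mem_colon_singleton, Submodule.mem_bot, Algebra.smul_def,
    Ideal.Quotient.algebraMap_eq, ← map_mul, Ideal.Quotient.eq_zero_iff_mem]

lemma regMod_of_forall_associatedPrimes [IsNoetherianRing R] {B : Ideal R} {x : R}
    (h : ∀ p ∈ associatedPrimes R (R ⧸ B), x ∉ p) : RegMod B x := by
  intro u hu
  by_contra hcon
  have : x ∈ ⋃ p ∈ associatedPrimes R (R ⧸ B), (p : Set R) := by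
    rw [biUnion_associatedPrimes_eq_zero_divisors]
    refine ⟨Ideal.Quotient.mk B u, by rwa [Ne, Ideal.Quotient.eq_zero_iff_mem], ?_⟩
    rw [Algebra.smul_def, Ideal.Quotient.algebraMap_eq, ← map_mul, Ideal.Quotient.eq_zero_iff_mem]
    exact hu
  obtain ⟨p, hp, hxp⟩ := Set.mem_iUnion₂.1 this
  exact h p hp hxp

lemma RegMod.notMem_of_mem_associatedPrimes [IsNoetherianRing R] {B p : Ideal R} {x : R}
    (h : RegMod B x) (hp : p ∈ associatedPrimes R (R ⧸ B)) : x ∉ p := by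
  obtain ⟨u, hu⟩ := exists_colon_of_mem_associatedPrimes hp
  intro hx
  have : (1 : R) ∈ p := (hu 1).2 (by simpa using h u ((hu x).1 hx))
  exact hp.isPrime.ne_top ((Ideal.eq_top_iff_one _).2 this)

/-- If yu ≡ zv modulo B, then v ≡ yw modulo B + (y), up to renaming w; cancelling y shows that u is
a multiple of z modulo B. -/
lemma RegMod.sup_span_comm {B : Ideal R} {y z : R} (hy : RegMod B y)
    (hz : RegMod (B ⊔ Ideal.span {y}) z) : RegMod (B ⊔ Ideal.span {z}) y := by
  intro u hu
  obtain ⟨v, hv⟩ := Ideal.mem_sup_span_singleton'.1 hu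
  have h1 : z * v ∈ B ⊔ Ideal.span {y} :=
    Ideal.mem_sup_span_singleton'.2 ⟨u, by simpa using neg_mem hv⟩
  obtain ⟨w, hw⟩ := Ideal.mem_sup_span_singleton'.1 (hz v h1)
  refine Ideal.mem_sup_span_singleton'.2 ⟨w, hy _ ?_⟩
  have := add_mem hv (Ideal.mul_mem_left _ z hw)
  convert this using 1
  ring

end RegularModulo

/-! ### Prime avoidance for cosets. -/

section PrimeAvoidance

variable {R : Type*} [CommRing R]

/-- An l in the product of L with the intersection of U₂ does not change x modulo the primes that
miss x; ordinary avoidance puts it outside the primes that contain x. -/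
lemma exists_add_notMem_of_antichain {U₁ U₂ : Finset (Ideal R)} (hprime : ∀ p ∈ U₁, p.IsPrime)
    {x : R} (h₁ : ∀ p ∈ U₁, x ∈ p) (h₂ : ∀ p ∈ U₂, x ∉ p) (hle : ∀ p ∈ U₁, ∀ q ∈ U₂, ¬ q ≤ p)
    {L : Ideal R} (hL : ∀ p ∈ U₁, ¬ L ≤ p) :
    ∃ l ∈ L, (∀ p ∈ U₁, x + l ∉ p) ∧ ∀ p ∈ U₂, x + l ∉ p := by
  obtain ⟨P, hP₁, hP₂⟩ : ∃ P : Ideal R, (∀ p ∈ U₁, ¬ P ≤ p) ∧ ∀ q ∈ U₂, P ≤ q := by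
    refine ⟨U₂.inf id, fun p hp h => ?_, fun q hq => Finset.inf_le (f := id) hq⟩
    obtain ⟨q, hq, hqp⟩ := (hprime p hp).inf_le'.1 h
    exact hle p hp q hq hqp
  have hlow : ¬ ∀ l ∈ L * P, ∃ p ∈ U₁, l ∈ p := by
    intro hsub
    obtain ⟨p, hp, h⟩ := (Ideal.subset_union_prime (s := U₁) (f := fun p => p) (I := L * P) ⊥ ⊥
      fun p hp _ _ => hprime p hp).1 fun l hl => Set.mem_iUnion₂.2 (by simpa using hsub l hl)
    rcases (hprime p hp).mul_le.1 h with h1 | h1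
    · exact hL p hp h1
    · exact hP₁ p hp h1
  push Not at hlow
  obtain ⟨l, hl, hlU⟩ := hlow
  have hl₁ : L * P ≤ L := Ideal.mul_le_left
  have hl₂ : L * P ≤ P := Ideal.mul_le_right
  refine ⟨l, hl₁ hl, fun p hp hmem => hlU p hp ?_, fun p hp hmem => h₂ p hp ?_⟩
  · exact (Ideal.add_mem_iff_right p (h₁ p hp)).1 hmem
  · exact (Ideal.add_mem_iff_left p (hP₂ p hp (hl₂ hl))).1 hmem

/-- Prime avoidance for cosets of ideals. -/
lemma exists_add_notMem_of_finite {T : Set (Ideal R)} (hT : T.Finite)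
    (hprime : ∀ p ∈ T, p.IsPrime) (x : R) (L : Ideal R) (h : ∀ p ∈ T, ¬ (x ∈ p ∧ L ≤ p)) :
    ∃ l ∈ L, ∀ p ∈ T, x + l ∉ p := by
  -- Only the maximal members of T matter, and these are pairwise incomparable.
  have hU₁ : {p | Maximal (· ∈ T) p ∧ x ∈ p}.Finite := hT.subset fun p hp => hp.1.prop
  have hU₂ : {p | Maximal (· ∈ T) p ∧ x ∉ p}.Finite := hT.subset fun p hp => hp.1.prop
  obtain ⟨l, hl, h₁, h₂⟩ := exists_add_notMem_of_antichain (U₁ := hU₁.toFinset)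
    (U₂ := hU₂.toFinset) (x := x) (L := L)
    (fun p hp => hprime p (hU₁.mem_toFinset.1 hp).1.prop)
    (fun p hp => (hU₁.mem_toFinset.1 hp).2) (fun p hp => (hU₂.mem_toFinset.1 hp).2)
    (fun p hp q hq hqp => by
      have hp := hU₁.mem_toFinset.1 hp
      have hq := hU₂.mem_toFinset.1 hq
      exact hq.2 (hq.1.eq_of_le hp.1.prop hqp ▸ hp.2))
    (fun p hp hle => h p (hU₁.mem_toFinset.1 hp).1.prop ⟨(hU₁.mem_toFinset.1 hp).2, hle⟩)
  refine ⟨l, hl, fun p hp hmem => ?_⟩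
  obtain ⟨q, hpq, hq⟩ := hT.exists_le_maximal hp
  by_cases hx : x ∈ q
  · exact h₁ q (hU₁.mem_toFinset.2 ⟨hq, hx⟩) (hpq hmem)
  · exact h₂ q (hU₂.mem_toFinset.2 ⟨hq, hx⟩) (hpq hmem)

lemma exists_add_regMod [IsNoetherianRing R] (B : Ideal R) (x : R) (L : Ideal R)
    (h : ∀ p ∈ associatedPrimes R (R ⧸ B), ¬ (x ∈ p ∧ L ≤ p)) :
    ∃ l ∈ L, RegMod B (x + l) := by
  obtain ⟨l, hl, hlT⟩ := exists_add_notMem_of_finite (associatedPrimes.finite R (R ⧸ B))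
    (fun p hp => hp.isPrime) x L h
  exact ⟨l, hl, regMod_of_forall_associatedPrimes hlT⟩

end PrimeAvoidance

/-! ### Depth in Noetherian local rings. -/

section LocalDepth

open IsLocalRing

variable {R : Type*} [CommRing R] [IsLocalRing R]

/-- `R ⧸ B` admits a weakly regular sequence of length `n` in the maximal ideal of `R`. -/
def HasDepth : ℕ → Ideal R → Prop
  | 0, _ => True
  | n + 1, B => ∃ y ∈ maximalIdeal R, RegMod B y ∧ HasDepth n (B ⊔ Ideal.span {y})

lemma HasDepth.pred {n : ℕ} {B : Ideal R} (h : HasDepth (n + 1) B) : HasDepth n B := by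
  induction n generalizing B with
  | zero => trivial
  | succ n ih =>
    obtain ⟨y, hy, hreg, h'⟩ := h
    exact ⟨y, hy, hreg, ih h'⟩

/-- Passing to the quotient by a nonzerodivisor does not make the socle nonzero, if it is zero
modulo another nonzerodivisor. -/
lemma mem_of_forall_mul_mem_of_regMod {B : Ideal R} {x y y' : R} (hxB : RegMod B x)
    (hy : y ∈ maximalIdeal R) (hyB : RegMod B y) (hy' : y' ∈ maximalIdeal R)
    (hreg : RegMod (B ⊔ Ideal.span {y}) y') {u : R}
    (hu : ∀ c ∈ maximalIdeal R, c * u ∈ B ⊔ Ideal.span {x}) : u ∈ B ⊔ Ideal.span {x} := by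
  obtain ⟨v, hv⟩ := Ideal.mem_sup_span_singleton'.1 (hu y hy)
  have key : y' * v ∈ B ⊔ Ideal.span {y} := by
    obtain ⟨w, hw⟩ := Ideal.mem_sup_span_singleton'.1 (hu y' hy')
    refine Ideal.mem_sup_span_singleton'.2 ⟨w, hxB _ ?_⟩
    have := sub_mem (Ideal.mul_mem_left _ y hw) (Ideal.mul_mem_left _ y' hv)
    convert this using 1
    ring
  obtain ⟨w, hw⟩ := Ideal.mem_sup_span_singleton'.1 (hreg v key)
  refine Ideal.mem_sup_span_singleton'.2 ⟨w, hyB _ ?_⟩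
  have := add_mem hv (Ideal.mul_mem_left _ x hw)
  convert this using 1
  ring

lemma hasDepth_of_forall_regMod (rs : List R) (B : Ideal R) (hrs : ∀ x ∈ rs, x ∈ maximalIdeal R)
    (h : ∀ i (hi : i < rs.length), RegMod (B ⊔ Ideal.ofList (rs.take i)) rs[i]) :
    HasDepth rs.length B := by
  induction rs generalizing B with
  | nil => trivial
  | cons x rs ih =>
    have h0 := h 0 (by simp)
    rw [List.take_zero, Ideal.ofList_nil, sup_bot_eq] at h0
    refine ⟨x, hrs x (by simp), h0, ih _ (fun z hz => hrs z (by simp [hz]))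
      fun i hi => ?_⟩
    have h1 := h (i + 1) (by simpa using hi)
    rwa [List.take_succ_cons, Ideal.ofList_cons, ← sup_assoc] at h1

lemma hasDepth_of_le_idealGrade {n : ℕ} (h : (n : ℕ∞) ≤ idealGrade (maximalIdeal R)) :
    HasDepth n (⊥ : Ideal R) := by
  have aux : ∀ m n : ℕ, n ≤ m → HasDepth m (⊥ : Ideal R) → HasDepth n (⊥ : Ideal R) := by
    intro m n hmn
    induction m, hmn using Nat.le_induction with
    | base => exact id
    | succ m _ ih => exact fun h => ih h.pred
  -- Arguing by contradiction bounds all lengths at once, so the supremum need not be shown to be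
  -- attained.
  by_contra hcon
  cases n with
  | zero => exact hcon trivial
  | succ n =>
    have : idealGrade (maximalIdeal R) ≤ n := by
      refine iSup₂_le fun rs hrs => ?_
      have h1 : HasDepth rs.length (⊥ : Ideal R) := hasDepth_of_forall_regMod rs ⊥ hrs.1
        fun i hi => by
          rw [bot_sup_eq]
          exact (isSMulRegular_quotient_iff_regMod _ _).1 (hrs.2.regular_mod_prev i hi)
      by_contra hlt
      refine hcon (aux _ _ ?_ h1)
      rw [not_le] at hlt
      exact_mod_cast hlt
    have h2 := h.trans this
    rw [Nat.cast_le] at h2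
    omega

variable [IsNoetherianRing R]

/-- Zero socle means that the maximal ideal is not associated to R/B, so prime avoidance applies to
the associated primes of all B ∈ T together. -/
lemma exists_regMod_of_socle {T : Set (Ideal R)} (hT : T.Finite)
    (h : ∀ B ∈ T, ∀ u, (∀ c ∈ maximalIdeal R, c * u ∈ B) → u ∈ B) :
    ∃ z ∈ maximalIdeal R, ∀ B ∈ T, RegMod B z := by
  obtain ⟨z, hz, hzT⟩ := exists_add_notMem_of_finite
    (T := ⋃ B ∈ T, associatedPrimes R (R ⧸ B))
    (hT.biUnion fun B _ => associatedPrimes.finite R (R ⧸ B))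
    (fun p hp => by
      obtain ⟨B, -, hp⟩ := Set.mem_iUnion₂.1 hp
      exact hp.isPrime) 0 (maximalIdeal R) (by
      rintro p hp ⟨-, hle⟩
      obtain ⟨B, hB, hp⟩ := Set.mem_iUnion₂.1 hp
      obtain ⟨u, hu⟩ := exists_colon_of_mem_associatedPrimes hp
      have h1 := h B hB u fun c hc => (hu c).1 (hle hc)
      exact hp.isPrime.ne_top ((Ideal.eq_top_iff_one _).2 ((hu 1).2 (by simpa using h1))))
  refine ⟨z, hz, fun B hB => regMod_of_forall_associatedPrimes fun p hp => ?_⟩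
  simpa using hzT p (Set.mem_iUnion₂.2 ⟨B, hB, hp⟩)

/-- The depth drops by at most one modulo a nonzerodivisor. -/
lemma HasDepth.sup_span {n : ℕ} {B : Ideal R} (h : HasDepth (n + 1) B) {x : R}
    (hx : x ∈ maximalIdeal R) (hxB : RegMod B x) : HasDepth n (B ⊔ Ideal.span {x}) := by
  induction n generalizing B x with
  | zero => trivial
  | succ n ih =>
    obtain ⟨y, hy, hyB, h'⟩ := h
    obtain ⟨y', hy', hyB', -⟩ := id h'
    -- An auxiliary z regular modulo B, B + (x) and B + (y) links x to y: induction passes from B +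
    -- (y) to B + (y, z), the exchange lemma makes y regular modulo B + (z), and induction then
    -- passes from B + (z) to B + (z, x).
    obtain ⟨z, hz, hzT⟩ := exists_regMod_of_socle
      (T := {B, B ⊔ Ideal.span {x}, B ⊔ Ideal.span {y}}) (by simp) (by
        rintro C (rfl | rfl | rfl) u hu
        · exact hyB u (hu y hy)
        · exact mem_of_forall_mul_mem_of_regMod hxB hy hyB hy' hyB' hu
        · exact hyB' u (hu y' hy'))
    have hzB := hzT B (by simp)
    have hzx := hzT (B ⊔ Ideal.span {x}) (by simp)
    have hzy := hzT (B ⊔ Ideal.span {y}) (by simp)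
    have h1 : HasDepth (n + 1) (B ⊔ Ideal.span {z}) := by
      refine ⟨y, hy, hyB.sup_span_comm hzy, ?_⟩
      rw [sup_right_comm]
      exact ih h' hz hzy
    refine ⟨z, hz, hzx, ?_⟩
    rw [sup_right_comm]
    exact ih h1 hx (hxB.sup_span_comm hzx)

lemma HasDepth.of_regChain {n k : ℕ} {B : Ideal R} (h : HasDepth n (⊥ : Ideal R))
    (hB : RegChain (maximalIdeal R) k B) : HasDepth (n - k) B := by
  induction hB with
  | bot => exact h
  | @step k B x _ hx hreg ih =>
    -- The subtraction is truncated: for k ≥ n nothing is claimed.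
    rcases Nat.eq_zero_or_pos (n - k) with h0 | h0
    · rw [show n - (k + 1) = 0 by omega]
      trivial
    · refine HasDepth.sup_span ?_ hx hreg
      rwa [show n - (k + 1) + 1 = n - k by omega]

/-- The depth of `R ⧸ B` is at most the dimension of `R ⧸ p` for associated primes `p`. -/
lemma HasDepth.height_add_le {n : ℕ} {B p : Ideal R} (h : HasDepth n B)
    (hp : p ∈ associatedPrimes R (R ⧸ B)) : p.height + n ≤ (maximalIdeal R).height := by
  induction n generalizing B p with
  | zero => simpa using Ideal.height_mono (le_maximalIdeal hp.isPrime.ne_top)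
  | succ n ih =>
    obtain ⟨y, hy, hyB, h'⟩ := h
    obtain ⟨u, hu⟩ := exists_colon_of_mem_associatedPrimes hp
    have hyp := hyB.notMem_of_mem_associatedPrimes hp
    let N : Ideal R := Submodule.colon B (p : Set R)
    have hN : ∀ v, v ∈ N ↔ ∀ c ∈ p, c * v ∈ B := fun v => by
      simp [N, Submodule.mem_colon, mul_comm]
    -- If N = (B : p) were inside B + (y), regularity of y would give N ⊆ B + yN, hence N ⊆ B by
    -- Nakayama, although u ∈ N lies outside B.
    have hnot : ¬ N ≤ B ⊔ Ideal.span {y} := by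
      intro hle
      have hNB : N ≤ B := by
        refine Submodule.le_of_le_smul_of_le_jacobson_bot (I := maximalIdeal R)
          (IsNoetherian.noetherian N) (maximalIdeal_le_jacobson _) fun v hv => ?_
        obtain ⟨w, hw⟩ := Ideal.mem_sup_span_singleton'.1 (hle hv)
        have hwN : w ∈ N := by
          rw [hN] at hv ⊢
          intro c hc
          refine hyB _ ?_
          have := sub_mem (hv c hc) (Ideal.mul_mem_left _ c hw)
          convert this using 1
          ring
        have := Submodule.add_mem_sup hw (Submodule.smul_mem_smul hy hwN)
        simpa using this
      have huB : u ∈ B := hNB ((hN u).2 fun c hc => (hu c).1 hc)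
      exact hp.isPrime.ne_top ((Ideal.eq_top_iff_one _).2 ((hu 1).2 (by simpa using huB)))
    obtain ⟨v, hvN, hv⟩ := SetLike.not_le_iff_exists.1 hnot
    -- Both p and y multiply v into B + (y), so q contains p strictly; the gain in height pays for
    -- the drop in depth.
    obtain ⟨q, hq, hle⟩ := exists_le_isAssociatedPrime_of_isNoetherianRing R
      (Ideal.Quotient.mk (B ⊔ Ideal.span {y}) v) (by rwa [Ne, Ideal.Quotient.eq_zero_iff_mem])
    have hmem : ∀ c, c * v ∈ B ⊔ Ideal.span {y} → c ∈ q := by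
      intro c hc
      refine hle ?_
      rw [Submodule.mem_colon_singleton, Submodule.mem_bot, Algebra.smul_def,
        Ideal.Quotient.algebraMap_eq, ← map_mul, Ideal.Quotient.eq_zero_iff_mem]
      exact hc
    have hpq : p < q := by
      refine lt_of_le_of_ne (fun c hc => hmem c (Ideal.mem_sup_left ((hN v).1 hvN c hc))) ?_
      rintro rfl
      exact hyp (hmem y (Ideal.mem_sup_right
        (Ideal.mul_mem_right _ _ (Ideal.mem_span_singleton_self y))))
    have := hp.isPrime
    have := hq.isPrime
    have h1 := Ideal.height_add_one_le_of_lt_of_isPrime hpq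
    calc p.height + ((n + 1 : ℕ) : ℕ∞) = p.height + 1 + n := by push_cast; ring
      _ ≤ q.height + n := by gcongr
      _ ≤ _ := ih h' hq

/-- Unmixedness in a Cohen-Macaulay local ring. -/
lemma height_le_of_regChain_of_isLocalRing
    (hCM : (idealGrade (maximalIdeal R) : WithBot ℕ∞) = ringKrullDim R) {k : ℕ} {B p : Ideal R}
    (hB : RegChain (maximalIdeal R) k B) (hp : p ∈ associatedPrimes R (R ⧸ B)) :
    p.height ≤ k := by
  rw [← maximalIdeal_height_eq_ringKrullDim, WithBot.coe_inj] at hCM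
  obtain ⟨d, hd⟩ := ENat.ne_top_iff_exists.1 (Ideal.height_ne_top_of_isPrime (I := maximalIdeal R))
  have h := ((hasDepth_of_le_idealGrade (n := d) (by rw [hCM, hd])).of_regChain
    hB).height_add_le hp
  rw [← hd] at h
  obtain ⟨e, he⟩ := ENat.ne_top_iff_exists.1 (ne_top_of_le_ne_top (ENat.natCast_ne_top d)
    (le_self_add.trans h))
  rw [← he] at h ⊢
  norm_cast at h ⊢
  omega

end LocalDepth

/-! ### Unmixedness and heights in Cohen-Macaulay rings. -/

section CohenMacaulay

variable {R : Type*} [CommRing R]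

/-- Unmixedness in a Cohen-Macaulay ring. -/
lemma IsCohenMacaulayRing.height_le_of_regChain (hR : IsCohenMacaulayRing R) {𝔞 : Ideal R} {k : ℕ}
    {B p : Ideal R} (hB : RegChain 𝔞 k B) (hp : p ∈ associatedPrimes R (R ⧸ B)) :
    p.height ≤ k := by
  have := hR.1
  have hpp := hp.isPrime
  obtain ⟨m, hm, hpm⟩ := Ideal.exists_le_maximal p hpp.ne_top
  let S := Localization.AtPrime m
  obtain ⟨u, hu⟩ := exists_colon_of_mem_associatedPrimes hp
  have hBp : B ≤ p := fun b hb => (hu b).2 (Ideal.mul_mem_right _ _ hb)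
  have hdisj : Disjoint (m.primeCompl : Set R) (p : Set R) :=
    Set.disjoint_left.2 fun x hx hxp => hx (hpm hxp)
  have hS : IsNoetherianRing S := IsLocalization.isNoetherianRing m.primeCompl S hR.1
  have hpS : (p.map (algebraMap R S)).IsPrime :=
    IsLocalization.isPrime_of_isPrime_disjoint m.primeCompl S p hpp hdisj
  rw [← IsLocalization.height_map_of_disjoint (S := S) m.primeCompl p hdisj]
  refine height_le_of_regChain_of_isLocalRing (hR.2 m) (B := B.map (algebraMap R S))
    (((hB.mono hBp).map m.primeCompl S).mono ((Ideal.map_mono hBp).trans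
      (IsLocalRing.le_maximalIdeal hpS.ne_top))) ?_
  refine isAssociatedPrime_iff.2 ⟨hpS, Ideal.Quotient.mk _ (algebraMap R S u), ?_⟩
  ext c
  rw [Submodule.mem_colon_singleton, Submodule.mem_bot, Algebra.smul_def,
    Ideal.Quotient.algebraMap_eq, ← map_mul, Ideal.Quotient.eq_zero_iff_mem]
  obtain ⟨⟨a, s⟩, hs⟩ := IsLocalization.surj m.primeCompl c
  rw [← Ideal.mul_unit_mem_iff_mem _ (IsLocalization.map_units S s), hs,
    ← Ideal.mul_unit_mem_iff_mem (B.map (algebraMap R S)) (IsLocalization.map_units S s),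
    mul_right_comm, hs, ← map_mul,
    IsLocalization.algebraMap_mem_map_algebraMap_iff m.primeCompl,
    IsLocalization.algebraMap_mem_map_algebraMap_iff m.primeCompl]
  simp only [hu, mul_assoc]

/-- In a Cohen-Macaulay ring, the first `k` generators of an ideal of height at least `k` can be
chosen to be a weakly regular sequence. -/
lemma IsCohenMacaulayRing.exists_regChain (hR : IsCohenMacaulayRing R) {𝔞 : Ideal R} {n : ℕ}
    (a : Fin n → R) (ha : Ideal.span (Set.range a) = 𝔞) {k : ℕ} (hk : k ≤ n)
    (hht : (k : ℕ∞) ≤ 𝔞.height) :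
    ∃ (B : Ideal R) (l : List R), RegChain 𝔞 k B ∧ l.length + k = n ∧ B ⊔ Ideal.ofList l = 𝔞 := by
  have := hR.1
  induction k with
  | zero =>
    refine ⟨⊥, List.ofFn a, .bot, by simp, ?_⟩
    rw [bot_sup_eq, ← ha, Ideal.ofList]
    congr 1
    ext x
    simp
  | succ k ih =>
    obtain ⟨B, l, hB, hl, hsup⟩ := ih (by omega)
      (le_trans (by exact_mod_cast Nat.le_succ k) hht)
    cases l with
    | nil => simp at hl; omega
    | cons x l =>
      rw [Ideal.ofList_cons] at hsup
      -- Changing x by a combination of the later generators preserves the generated ideal. An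
      -- obstructing associated prime of B would contain 𝔞, of height at least k + 1, yet has height
      -- at most k.
      obtain ⟨y, hy, hreg⟩ := exists_add_regMod B x (Ideal.ofList l) (by
        rintro p hp ⟨hxp, hle⟩
        obtain ⟨u, hu⟩ := exists_colon_of_mem_associatedPrimes hp
        have hBp : B ≤ p := fun b hb => (hu b).2 (Ideal.mul_mem_right _ _ hb)
        have h1 : 𝔞 ≤ p := by
          rw [← hsup]
          exact sup_le hBp (sup_le ((Ideal.span_singleton_le_iff_mem _).2 hxp) hle)
        have h2 := (hht.trans (Ideal.height_mono h1)).trans (hR.height_le_of_regChain hB hp)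
        rw [Nat.cast_le] at h2
        omega)
      have hx𝔞 : x ∈ 𝔞 := hsup ▸ Ideal.mem_sup_right
        (Ideal.mem_sup_left (Ideal.mem_span_singleton_self x))
      have hy𝔞 : y ∈ 𝔞 := hsup ▸ Ideal.mem_sup_right (Ideal.mem_sup_right hy)
      refine ⟨_, l, hB.step (add_mem hx𝔞 hy𝔞) hreg, by simp at hl; omega, ?_⟩
      refine le_antisymm (sup_le (sup_le hB.le
        ((Ideal.span_singleton_le_iff_mem _).2 (add_mem hx𝔞 hy𝔞))) ?_) ?_
      · rw [← hsup]
        exact le_sup_right.trans le_sup_right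
      · rw [← hsup]
        refine sup_le (le_sup_left.trans le_sup_left) (sup_le ?_ le_sup_right)
        rw [Ideal.span_singleton_le_iff_mem]
        have := sub_mem (Ideal.mem_sup_left (T := Ideal.ofList l) (Ideal.mem_sup_right (S := B)
          (Ideal.mem_span_singleton_self (x + y)))) (Ideal.mem_sup_right hy)
        simpa using this

/-- By unmixedness the associated primes of R/B have height at most k, so none contains J. -/
lemma IsCohenMacaulayRing.exists_regMod (hR : IsCohenMacaulayRing R) {𝔞 : Ideal R} {k : ℕ}
    {B : Ideal R} (hB : RegChain 𝔞 k B) {J : Ideal R} (hJ : ((k + 1 : ℕ) : ℕ∞) ≤ J.height) :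
    ∃ y ∈ J, RegMod B y := by
  have := hR.1
  obtain ⟨y, hy, hreg⟩ := exists_add_regMod B 0 J (by
    rintro p hp ⟨-, hle⟩
    have h2 := (hJ.trans (Ideal.height_mono hle)).trans (hR.height_le_of_regChain hB hp)
    rw [Nat.cast_le] at h2
    omega)
  exact ⟨y, hy, by simpa using hreg⟩

/-- Since I·(𝔞 : I) ⊆ 𝔞, each minimal prime of 𝔞 contains one of the two factors. -/
lemma min_height_le_height_of_colon {𝔞 I : Ideal R} :
    min I.height (Submodule.colon 𝔞 (I : Set R)).height ≤ 𝔞.height := by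
  rw [Ideal.height_eq_inf_minimalPrimes 𝔞]
  refine le_iInf₂ fun p hp => ?_
  have hpp := hp.isPrime
  have hle := hp.1.2
  have hmul : I * Submodule.colon 𝔞 (I : Set R) ≤ p := by
    refine Ideal.mul_le.2 fun x hx y hy => hle ?_
    rw [mul_comm]
    exact Submodule.mem_colon.1 hy x hx
  rcases hpp.mul_le.1 hmul with h | h
  · exact (min_le_left _ _).trans (Ideal.height_mono h)
  · exact (min_le_right _ _).trans (Ideal.height_mono h)

end CohenMacaulay

/-! ### Coefficients modulo an ideal in free modules. -/

section IdealMultiples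

variable {R M N : Type*} [CommRing R] [AddCommGroup M] [Module R M] [AddCommGroup N] [Module R N]

lemma LinearMap.map_mem_ideal_smul_top (f : M →ₗ[R] N) {B : Ideal R} {w : M}
    (hw : w ∈ B • (⊤ : Submodule R M)) : f w ∈ B • (⊤ : Submodule R N) :=
  Submodule.smul_top_le_comap_smul_top B f hw

lemma Module.Basis.mem_ideal_smul_top_iff {ι : Type*} (b : Module.Basis ι R M) {B : Ideal R}
    {w : M} : w ∈ B • (⊤ : Submodule R M) ↔ ∀ i, b.repr w i ∈ B := by
  constructor
  · intro h i
    simpa using (b.coord i).map_mem_ideal_smul_top h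
  · intro h
    rw [← b.linearCombination_repr w, Finsupp.linearCombination_apply]
    exact Submodule.sum_mem _ fun i _ => Submodule.smul_mem_smul (h i) trivial

lemma RegMod.mem_of_smul_mem [Module.Free R M] {B : Ideal R} {x : R} (h : RegMod B x) {w : M}
    (hw : x • w ∈ B • (⊤ : Submodule R M)) : w ∈ B • (⊤ : Submodule R M) := by
  have b := Module.Free.chooseBasis R M
  rw [b.mem_ideal_smul_top_iff] at hw ⊢
  exact fun i => h _ (by simpa using hw i)

end IdealMultiples

instance ExteriorAlgebra.free {R M : Type*} [CommRing R] [AddCommGroup M] [Module R M]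
    [Module.Free R M] : Module.Free R (ExteriorAlgebra R M) :=
  Module.Free.of_equiv
    (DirectSum.decomposeLinearEquiv fun i : ℕ => ⋀[R]^i M).symm

/-! ### The Koszul differential and the algebra generated by Γ and the cycles. -/

section Koszul

variable {R : Type*} [CommRing R] {r t : ℕ} (f : Fin r → R) (Φ : Matrix (Fin r) (Fin t) R)

lemma koszulDifferential_ι_mul (v : Fin r → R) (w : ExteriorAlgebra R (Fin r → R)) :
    koszulDifferential f (ExteriorAlgebra.ι R v * w) =
      (∑ i, v i * f i) • w - ExteriorAlgebra.ι R v * koszulDifferential f w := by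
  have := CliffordAlgebra.contractLeft_ι_mul (Q := (0 : QuadraticForm R (Fin r → R)))
    (Fintype.linearCombination R f) v w
  simp only [Fintype.linearCombination_apply, smul_eq_mul] at this
  exact this

lemma koszulDifferential_koszulDifferential (w : ExteriorAlgebra R (Fin r → R)) :
    koszulDifferential f (koszulDifferential f w) = 0 :=
  CliffordAlgebra.contractLeft_contractLeft (Q := (0 : QuadraticForm R (Fin r → R))) _ w

/-- The Leibniz rule; the grade involution carries the sign, so no homogeneity is needed. -/
lemma koszulDifferential_mul (x y : ExteriorAlgebra R (Fin r → R)) :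
    koszulDifferential f (x * y) = koszulDifferential f x * y +
      CliffordAlgebra.involute x * koszulDifferential f y := by
  induction x using CliffordAlgebra.left_induction with
  | algebraMap c =>
    simp [koszulDifferential, CliffordAlgebra.contractLeft_algebraMap_mul,
      CliffordAlgebra.contractLeft_algebraMap]
  | add x₁ x₂ h₁ h₂ => simp only [add_mul, map_add, h₁, h₂]; abel
  | ι_mul x v ih =>
    have h1 := koszulDifferential_ι_mul f v (x * y)
    have h2 := koszulDifferential_ι_mul f v x
    rw [ExteriorAlgebra.ι] at h1 h2
    rw [mul_assoc, h1, h2, ih, map_mul, CliffordAlgebra.involute_ι]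
    simp only [mul_add, sub_mul, neg_mul, mul_assoc, smul_mul_assoc]
    abel

/-- The differential as a linear function of the sequence. -/
lemma koszulDifferential_add_smul (f g : Fin r → R) (c : R) (w : ExteriorAlgebra R (Fin r → R)) :
    koszulDifferential (f + c • g) w = koszulDifferential f w + c • koszulDifferential g w := by
  have h : Fintype.linearCombination R (f + c • g) =
      Fintype.linearCombination R f + c • Fintype.linearCombination R g := by
    ext; simp [Fintype.linearCombination_apply, Pi.single_apply]
  simp only [koszulDifferential, h, map_add, map_smul, LinearMap.add_apply, LinearMap.smul_apply]

lemma koszulDifferential_smul_left (g : Fin r → R) (c : R) (w : ExteriorAlgebra R (Fin r → R)) :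
    koszulDifferential (c • g) w = c • koszulDifferential g w := by
  have h : Fintype.linearCombination R (c • g) = c • Fintype.linearCombination R g := by
    ext; simp [Fintype.linearCombination_apply, Pi.single_apply]
  simp only [koszulDifferential, h, map_smul, LinearMap.smul_apply]

lemma koszulDifferential_mem_of_forall_mem {B : Ideal R} (hf : ∀ i, f i ∈ B)
    (w : ExteriorAlgebra R (Fin r → R)) :
    koszulDifferential f w ∈ B • (⊤ : Submodule R (ExteriorAlgebra R (Fin r → R))) := by
  induction w using CliffordAlgebra.left_induction with
  | algebraMap c => simp [koszulDifferential, CliffordAlgebra.contractLeft_algebraMap]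
  | add x y hx hy => rw [map_add]; exact add_mem hx hy
  | ι_mul x v ih =>
    have h1 := koszulDifferential_ι_mul f v x
    rw [ExteriorAlgebra.ι] at h1
    rw [h1]
    exact sub_mem (Submodule.smul_mem_smul (Ideal.sum_mem _ fun i _ => B.mul_mem_left _ (hf i))
      trivial) ((LinearMap.mulLeft R _).map_mem_ideal_smul_top ih)

/-- The subalgebra of the Koszul complex generated by `Γ` and the Koszul cycles. -/
noncomputable def gammaCycles : Subalgebra R (ExteriorAlgebra R (Fin r → R)) :=
  Algebra.adjoin R ((koszulGamma Φ : Set (ExteriorAlgebra R (Fin r → R))) ∪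
    (koszulCycles f : Set (ExteriorAlgebra R (Fin r → R))))

lemma mem_kitt_iff {x : R} : x ∈ kitt f Φ ↔ x • koszulTop R r ∈ gammaCycles f Φ := Iff.rfl

variable {f Φ}

lemma mem_gammaCycles_of_cycle {w : ExteriorAlgebra R (Fin r → R)}
    (hw : koszulDifferential f w = 0) : w ∈ gammaCycles f Φ :=
  Algebra.subset_adjoin (Or.inr hw)

lemma ι_single_sum (Φ : Matrix (Fin r) (Fin t) R) (j : Fin t) :
    ∑ i : Fin r, Φ i j • ExteriorAlgebra.ι R (Pi.single i (1 : R)) =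
      ExteriorAlgebra.ι R (fun i => Φ i j) := by
  simp only [← map_smul, ← map_sum]
  congr 1
  ext k
  simp [Finset.sum_apply, Pi.single_apply]

/-- Every element of the ideal generated by `f Φ` is the boundary of an element of `Γ` of
degree one. -/
lemma exists_ι_mem_gammaCycles {b : R}
    (hb : b ∈ Ideal.span (Set.range (Matrix.vecMul f Φ))) :
    ∃ v : Fin r → R, ∑ i, v i * f i = b ∧ ExteriorAlgebra.ι R v ∈ gammaCycles f Φ := by
  rw [Ideal.mem_span_range_iff_exists_fun] at hb
  obtain ⟨c, rfl⟩ := hb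
  refine ⟨∑ j, c j • fun i => Φ i j, ?_, ?_⟩
  · simp only [Finset.sum_apply, Pi.smul_apply, smul_eq_mul, Finset.sum_mul, Matrix.vecMul,
      dotProduct, Finset.mul_sum]
    rw [Finset.sum_comm]
    exact Finset.sum_congr rfl fun j _ => Finset.sum_congr rfl fun i _ => by ring
  · rw [map_sum]
    refine sum_mem fun j _ => ?_
    rw [map_smul, ← ι_single_sum]
    have h : (koszulGamma Φ : Set (ExteriorAlgebra R (Fin r → R))) ⊆ gammaCycles f Φ :=
      Set.subset_union_left.trans Algebra.subset_adjoin
    exact Subalgebra.smul_mem _ (h (Algebra.subset_adjoin ⟨j, rfl⟩)) _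

/-- Cycles modulo a regular sequence in the ideal generated by `f Φ` lift to the algebra generated
by `Γ` and the cycles. -/
lemma RegChain.mem_gammaCycles {k : ℕ} {B : Ideal R}
    (hB : RegChain (Ideal.span (Set.range (Matrix.vecMul f Φ))) k B)
    {w : ExteriorAlgebra R (Fin r → R)}
    (hw : koszulDifferential f w ∈ B • (⊤ : Submodule R (ExteriorAlgebra R (Fin r → R)))) :
    w ∈ gammaCycles f Φ := by
  induction hB generalizing w with
  | bot => exact mem_gammaCycles_of_cycle (by simpa using hw)
  | @step k B x hB hx hreg ih =>
    rw [Submodule.sup_smul] at hw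
    obtain ⟨β, hβ, γ, hγ, hsum⟩ := Submodule.mem_sup.1 hw
    rw [Submodule.ideal_span_singleton_smul] at hγ
    obtain ⟨u, -, rfl⟩ := (Submodule.mem_smul_pointwise_iff_exists _ _ _).1 hγ
    -- Here ∂w = β + xu with β ∈ BK; applying ∂ gives x ∂u = −∂β, and x can be cancelled modulo B.
    have hu : koszulDifferential f u ∈ B • (⊤ : Submodule R (ExteriorAlgebra R (Fin r → R))) := by
      refine hreg.mem_of_smul_mem ?_
      have h0 := koszulDifferential_koszulDifferential f w
      rw [← hsum, map_add, map_smul] at h0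
      rw [eq_neg_of_add_eq_zero_right h0]
      exact neg_mem (LinearMap.map_mem_ideal_smul_top _ hβ)
    obtain ⟨v, hvx, hv⟩ := exists_ι_mem_gammaCycles hx
    -- Since ∂(ι v) = x, subtracting ι v · u removes the term xu from ∂w, leaving β + ι v · ∂u.
    have h1 : koszulDifferential f (w - ExteriorAlgebra.ι R v * u) ∈
        B • (⊤ : Submodule R (ExteriorAlgebra R (Fin r → R))) := by
      rw [map_sub, koszulDifferential_ι_mul, hvx, ← hsum]
      have := add_mem hβ ((LinearMap.mulLeft R (ExteriorAlgebra.ι R v)).map_mem_ideal_smul_top hu)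
      convert this using 1
      simp only [LinearMap.mulLeft_apply]
      abel
    have := add_mem (ih h1) (mul_mem hv (ih hu))
    simpa using this

lemma ι_mul_koszulTop (v : Fin r → R) : ExteriorAlgebra.ι R v * koszulTop R r = 0 := by
  have hv : v = ∑ i, v i • (Pi.single i 1 : Fin r → R) := by
    ext j
    simp [Finset.sum_apply, Pi.single_apply]
  rw [hv, map_sum, Finset.sum_mul]
  refine Finset.sum_eq_zero fun i _ => ?_
  rw [map_smul, smul_mul_assoc]
  have h := ExteriorAlgebra.ιMulti_succ_apply (R := R)
    (Matrix.vecCons (Pi.single i 1 : Fin r → R) fun j => Pi.single j 1)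
  rw [(ExteriorAlgebra.ιMulti R (r + 1)).map_eq_zero_of_eq _ (i := 0) (j := i.succ) (by simp)
    (Fin.succ_ne_zero i).symm] at h
  simp only [Matrix.cons_val_zero, Matrix.vecTail, Function.comp_def, Matrix.cons_val_succ] at h
  rw [koszulTop]
  exact (congrArg _ h.symm).trans (smul_zero _)

/-- The determinant, extended by zero to the other degrees, is a linear form on the exterior algebra
with value 1 on the top element. -/
lemma mem_of_smul_koszulTop_mem {B : Ideal R} {c : R}
    (hc : c • koszulTop R r ∈ B • (⊤ : Submodule R (ExteriorAlgebra R (Fin r → R)))) : c ∈ B := by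
  classical
  let ψ : ∀ i, (Fin r → R) [⋀^Fin i]→ₗ[R] R := fun i =>
    if h : i = r then (h ▸ Matrix.detRowAlternating : (Fin r → R) [⋀^Fin i]→ₗ[R] R) else 0
  have h := (ExteriorAlgebra.liftAlternating (R := R) ψ).map_mem_ideal_smul_top hc
  have h1 : (Matrix.detRowAlternating fun i : Fin r => (Pi.single i 1 : Fin r → R)) = (1 : R) := by
    rw [← Matrix.det_one (n := Fin r)]
    congr 1
    ext i j
    simp [Matrix.one_apply, Pi.single_apply, eq_comm]
  rw [map_smul, koszulTop, ExteriorAlgebra.liftAlternating_apply_ιMulti] at h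
  simpa [ψ, h1] using h

/-- Elements whose boundary lies in 𝔞K are closed under products and include Γ and the cycles.
Differentiating e_i ∧ e = 0 then recovers x f_i from ∂(xe). -/
lemma kitt_le_colon : kitt f Φ ≤ Submodule.colon
    (Ideal.span (Set.range (Matrix.vecMul f Φ))) (Ideal.span (Set.range f) : Set R) := by
  set 𝔞 := Ideal.span (Set.range (Matrix.vecMul f Φ)) with h𝔞
  have hA : ∀ w ∈ gammaCycles f Φ, koszulDifferential f w ∈
      𝔞 • (⊤ : Submodule R (ExteriorAlgebra R (Fin r → R))) := by
    have hmul : ∀ x y : ExteriorAlgebra R (Fin r → R),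
        koszulDifferential f x ∈ 𝔞 • (⊤ : Submodule R (ExteriorAlgebra R (Fin r → R))) →
        koszulDifferential f y ∈ 𝔞 • (⊤ : Submodule R (ExteriorAlgebra R (Fin r → R))) →
        koszulDifferential f (x * y) ∈
          𝔞 • (⊤ : Submodule R (ExteriorAlgebra R (Fin r → R))) := by
      intro x y hx hy
      rw [koszulDifferential_mul]
      exact add_mem ((LinearMap.mulRight R y).map_mem_ideal_smul_top hx)
        ((LinearMap.mulLeft R _).map_mem_ideal_smul_top hy)
    have halg : ∀ c : R, koszulDifferential f (algebraMap R _ c) ∈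
        𝔞 • (⊤ : Submodule R (ExteriorAlgebra R (Fin r → R))) := fun c => by
      simp [koszulDifferential, CliffordAlgebra.contractLeft_algebraMap]
    intro w hw
    induction hw using Algebra.adjoin_induction with
    | mem w hw =>
      rcases hw with hw | hw
      · induction hw using Algebra.adjoin_induction with
        | mem w hw =>
          obtain ⟨j, rfl⟩ := hw
          have h := koszulDifferential_ι_mul f (fun i => Φ i j) 1
          have h0 := halg 1
          rw [map_one] at h0
          simp only [ι_single_sum]
          rw [← mul_one (ExteriorAlgebra.ι R _), h]
          refine sub_mem (Submodule.smul_mem_smul (Ideal.subset_span ⟨j, ?_⟩) trivial)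
            ((LinearMap.mulLeft R _).map_mem_ideal_smul_top h0)
          simp [Matrix.vecMul, dotProduct, mul_comm]
        | algebraMap c => exact halg c
        | add x y _ _ hx hy => rw [map_add]; exact add_mem hx hy
        | mul x y _ _ hx hy => exact hmul x y hx hy
      · have : koszulDifferential f w = 0 := hw
        simp [this]
    | algebraMap c => exact halg c
    | add x y _ _ hx hy => rw [map_add]; exact add_mem hx hy
    | mul x y _ _ hx hy => exact hmul x y hx hy
  intro x hx
  have hspan : Ideal.span (Set.range f) ≤ Submodule.comap (LinearMap.mulLeft R x) 𝔞 := by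
    rw [Ideal.span_le]
    rintro _ ⟨i, rfl⟩
    change x * f i ∈ 𝔞
    refine mem_of_smul_koszulTop_mem (r := r) ?_
    have h := koszulDifferential_ι_mul f (Pi.single i 1) (koszulTop R r)
    rw [ι_mul_koszulTop, map_zero, eq_comm, sub_eq_zero] at h
    have h1 := (LinearMap.mulLeft R (ExteriorAlgebra.ι R (Pi.single i (1 : R)))).map_mem_ideal_smul_top
      (hA _ hx)
    rw [LinearMap.toSpanSingleton_apply, map_smul, map_smul, LinearMap.mulLeft_apply, ← h] at h1
    simpa [Pi.single_apply, smul_smul] using h1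
  refine Submodule.mem_colon.2 fun y hy => hspan hy

/-- The colon ideal is contained in the Koszul-Fitting ideal if the ideal generated by `f Φ` is
generated by a weakly regular sequence and one more element, provided that the colon ideal contains
a nonzerodivisor modulo the regular sequence. -/
lemma RegChain.mem_kitt_of_sup_span {k : ℕ} {B : Ideal R}
    (hB : RegChain (Ideal.span (Set.range (Matrix.vecMul f Φ))) k B) {α : R}
    (hα : B ⊔ Ideal.span {α} = Ideal.span (Set.range (Matrix.vecMul f Φ))) {y : R}
    (hyreg : RegMod B y)
    (hy : ∀ i, y * f i ∈ Ideal.span (Set.range (Matrix.vecMul f Φ))) {x : R}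
    (hx : ∀ i, x * f i ∈ Ideal.span (Set.range (Matrix.vecMul f Φ))) : x ∈ kitt f Φ := by
  -- Writing z f_i ≡ α v_i modulo B gives z ∂ ≡ α ∂_v as operators modulo B.
  have hdecomp : ∀ z : R, (∀ i, z * f i ∈ Ideal.span (Set.range (Matrix.vecMul f Φ))) →
      ∃ v : Fin r → R, ∀ w, z • koszulDifferential f w - α • koszulDifferential v w ∈
        B • (⊤ : Submodule R (ExteriorAlgebra R (Fin r → R))) := by
    intro z hz
    choose v hv using fun i => Ideal.mem_sup_span_singleton'.1 (hα.symm ▸ hz i)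
    refine ⟨v, fun w => ?_⟩
    have h := koszulDifferential_mem_of_forall_mem (z • f + (-α) • v)
      (B := B) (fun i => by simpa [sub_eq_add_neg] using hv i) w
    rw [koszulDifferential_add_smul, koszulDifferential_smul_left, neg_smul] at h
    rwa [sub_eq_add_neg]
  obtain ⟨v, hv⟩ := hdecomp x hx
  obtain ⟨h, hh⟩ := hdecomp y hy
  set e := koszulTop R r
  have hmap : ∀ (g : Fin r → R) {w : ExteriorAlgebra R (Fin r → R)},
      w ∈ B • (⊤ : Submodule R (ExteriorAlgebra R (Fin r → R))) →
      koszulDifferential g w ∈ B • (⊤ : Submodule R (ExteriorAlgebra R (Fin r → R))) :=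
    fun g _ hw => LinearMap.map_mem_ideal_smul_top _ hw
  have hcycle : koszulDifferential f (koszulDifferential v e) ∈
      B • (⊤ : Submodule R (ExteriorAlgebra R (Fin r → R))) := by
    -- Modulo B, y² ∂∂_v e ≡ yα ∂_h ∂_v e ≡ xy ∂_h ∂e ≡ xα ∂_h ∂_h e = 0.
    refine hyreg.mem_of_smul_mem (hyreg.mem_of_smul_mem ?_)
    have h1 := Submodule.smul_mem _ y (hh (koszulDifferential v e))
    have h2 := Submodule.smul_mem _ y (hmap h (hv e))
    have h3 := Submodule.smul_mem _ x (hmap h (hh e))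
    have := sub_mem (add_mem h1 (neg_mem h2)) (neg_mem h3)
    convert this using 1
    simp only [map_sub, map_smul, koszulDifferential_koszulDifferential, smul_sub, smul_zero,
      smul_comm x y]
    module
  obtain ⟨ζ, hζα, hζ⟩ := exists_ι_mem_gammaCycles
    (hα ▸ Ideal.mem_sup_right (Ideal.mem_span_singleton_self α))
  have hrest : koszulDifferential f (x • e - ExteriorAlgebra.ι R ζ * koszulDifferential v e) ∈
      B • (⊤ : Submodule R (ExteriorAlgebra R (Fin r → R))) := by
    rw [map_sub, koszulDifferential_ι_mul, hζα, map_smul]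
    have := add_mem (hv e)
      ((LinearMap.mulLeft R (ExteriorAlgebra.ι R ζ)).map_mem_ideal_smul_top hcycle)
    convert this using 1
    simp only [LinearMap.mulLeft_apply]
    abel
  have := add_mem (hB.mem_gammaCycles hrest) (mul_mem hζ (hB.mem_gammaCycles hcycle))
  rw [sub_add_cancel] at this
  exact this

end Koszul

/-- The boundary of xe is the contraction of e by the vector x f, whose entries lie in 𝔞, so xe is a
cycle modulo the regular sequence. -/
lemma RegChain.mem_kitt {R : Type*} [CommRing R] {r t : ℕ} {f : Fin r → R}
    {Φ : Matrix (Fin r) (Fin t) R} {k : ℕ}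
    (h : RegChain (Ideal.span (Set.range (Matrix.vecMul f Φ))) k
      (Ideal.span (Set.range (Matrix.vecMul f Φ)))) {x : R}
    (hx : ∀ i, x * f i ∈ Ideal.span (Set.range (Matrix.vecMul f Φ))) : x ∈ kitt f Φ := by
  rw [mem_kitt_iff]
  refine h.mem_gammaCycles ?_
  rw [map_smul, ← koszulDifferential_smul_left]
  exact koszulDifferential_mem_of_forall_mem _ hx _

/-! ### Colon ideals and the theorem on residual intersections. -/

lemma mem_colon_span_range {R ι : Type*} [CommRing R] {𝔞 : Ideal R} {f : ι → R} {x : R} :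
    x ∈ Submodule.colon 𝔞 (Ideal.span (Set.range f) : Set R) ↔ ∀ i, x * f i ∈ 𝔞 := by
  rw [Submodule.mem_colon]
  refine ⟨fun h i => h _ (Ideal.subset_span ⟨i, rfl⟩), fun h y hy => ?_⟩
  have : Ideal.span (Set.range f) ≤ Submodule.comap (LinearMap.mulLeft R x) 𝔞 := by
    rw [Ideal.span_le]
    rintro _ ⟨i, rfl⟩
    exact h i
  exact this hy

/-- A residual intersection `(f 0) : I` containing a nonzerodivisor consists of the first
coordinates of the vectors proportional to `f`. -/
lemma mem_colon_span_singleton_iff {R : Type*} [CommRing R] {n : ℕ} {f : Fin (n + 1) → R} {y : R}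
    (hreg : RegMod ⊥ y)
    (hy : y ∈ Submodule.colon (Ideal.span {f 0}) (Ideal.span (Set.range f) : Set R)) (x : R) :
    x ∈ Submodule.colon (Ideal.span {f 0}) (Ideal.span (Set.range f) : Set R) ↔
      ∃ v : Fin (n + 1) → R, v 0 = x ∧ ∀ i j, (!![v i, v j; f i, f j]).det = 0 := by
  simp only [mem_colon_span_range, Ideal.mem_span_singleton'] at hy ⊢
  constructor
  · intro hx
    choose h hh using hy
    choose v hv using hx
    -- The chosen `v 0` only satisfies `v 0 * f 0 = x * f 0`, so it is replaced by x itself.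
    refine ⟨Fin.cons x fun i => v i.succ, rfl, fun i j => ?_⟩
    have hw : ∀ i, (Fin.cons x fun i => v i.succ : Fin (n + 1) → R) i * f 0 = x * f i := by
      intro i
      cases i using Fin.cases with
      | zero => rfl
      | succ i => exact hv i.succ
    generalize (Fin.cons x fun i => v i.succ : Fin (n + 1) → R) = w at hw
    rw [Matrix.det_fin_two_of]
    -- With y f_i = h_i f_0 and w_i f_0 = x f_i, the product y² w_i f_j equals x h_i h_j f_0, which
    -- is symmetric in i and j; hence y² kills the minor.
    refine hreg _ (hreg _ ?_)
    rw [Ideal.mem_bot]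
    linear_combination (-y * w i) * hh j + y * w j * hh i + y * h j * hw i - y * h i * hw j
      - x * h j * hh i + x * h i * hh j
  · rintro ⟨v, rfl, hv⟩ i
    have := hv 0 i
    rw [Matrix.det_fin_two_of] at this
    exact ⟨v i, by linear_combination -this⟩

theorem proposition5p8 {R : Type*} [CommRing R] (hR : IsCohenMacaulayRing R)
    (𝔞 I J : Ideal R) (g s : ℕ) (hg : I.height = g)
    (hJ : IsResidualIntersection 𝔞 I J s) (hs : s ≤ g + 1) :
    (∀ (r t : ℕ) (f : Fin r → R) (a : Fin t → R) (Φ : Matrix (Fin r) (Fin t) R),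
      Ideal.span (Set.range f) = I → Ideal.span (Set.range a) = 𝔞 → a = Matrix.vecMul f Φ →
        kitt f Φ = J) ∧
    (s = 1 → ∀ (n : ℕ) (f : Fin (n + 1) → R),
      Ideal.span (Set.range f) = I → Ideal.span {f 0} = 𝔞 →
        ∀ x : R, x ∈ J ↔ ∃ v : Fin (n + 1) → R, v 0 = x ∧
          ∀ i j, (!![v i, v j; f i, f j]).det = 0) := by
  obtain ⟨-, -, ⟨b, hb⟩, hcolon, hht⟩ := hJ
  have hmin : min (g : ℕ∞) s ≤ 𝔞.height := by
    refine le_trans (min_le_min hg.ge ?_) (min_height_le_height_of_colon (I := I))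
    rwa [← hcolon]
  constructor
  · rintro r t f _ Φ rfl ha rfl
    refine le_antisymm ?_ fun x hx => ?_
    · rw [hcolon, ← ha]
      exact kitt_le_colon
    have hxf := mem_colon_span_range.1 (hcolon ▸ hx)
    rcases hs.lt_or_eq with hlt | rfl
    · have hsg : s ≤ g := Nat.lt_succ_iff.1 hlt
      -- All s generators become a regular sequence, so none is left over.
      obtain ⟨B, l, hB, hl, hsup⟩ := hR.exists_regChain b hb le_rfl
        (by rwa [min_eq_right (by exact_mod_cast hsg)] at hmin)
      obtain rfl : l = [] := List.length_eq_zero_iff.1 (by omega)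
      rw [Ideal.ofList_nil, sup_bot_eq] at hsup
      subst hsup
      rw [← ha] at hB hxf
      exact hB.mem_kitt hxf
    -- Here s = g + 1: exactly one generator α remains beyond the regular sequence.
    · obtain ⟨B, l, hB, hl, hsup⟩ := hR.exists_regChain b hb (Nat.le_succ g)
        (by rwa [min_eq_left (by exact_mod_cast Nat.le_succ g)] at hmin)
      obtain ⟨α, rfl⟩ := List.length_eq_one_iff.1 (show l.length = 1 by omega)
      rw [Ideal.ofList_singleton] at hsup
      obtain ⟨y, hy, hyreg⟩ := hR.exists_regMod hB hht
      have hyf := mem_colon_span_range.1 (hcolon ▸ hy)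
      subst ha
      exact hB.mem_kitt_of_sup_span hsup hyreg hyf hxf
  · rintro rfl n f rfl rfl x
    -- For the empty sequence, height at least 1 makes J contain a nonzerodivisor of R.
    obtain ⟨y, hy, hyreg⟩ := hR.exists_regMod (.bot : RegChain ⊤ 0 (⊥ : Ideal R)) (by simpa using hht)
    rw [hcolon] at hy ⊢
    exact mem_colon_span_singleton_iff hyreg hy x
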